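/- Notation. $B(x,r)$ is the open ball in $\mathbb{R}^n$ with Lebesgue measure $|B(x,r)|$. A Young function is a convex, left-continuous $\Phi:[0,\infty)\to[0,\infty]$ with $\lim_{r\to 0+}\Phi(r)=\Phi(0)=0$ and $\lim_{r\to\infty}\Phi(r)=\infty$; put $\Phi^{-1}(s)=\inf\{r\ge 0:\Phi(r)>s\}$. We write $\Phi\in\Delta'$ if $\Phi$ is a Young function and, for some $C>1$, $\Phi(tr)\le C\,\Phi(t)\Phi(r)$ for all $t,r\ge 0$. For such functions let $$\|f\|_{L^\Phi}=\inf\Big\{\lambda>0:\int_{\mathbb{R}^n}\Phi\big(|f(x)|/\lambda\big)\,dx\le 1\Big\},\qquad \|f\|_{WL^\Phi}=\inf\Big\{\lambda>0:\sup_{t>0}\Phi(t/\lambda)\,|\{x:|f(x)|>t\}|\le 1\Big\},$$ let $L^\Phi(\mathbb{R}^n)$ be the set of $f\in L^1_{\rm loc}(\mathbb{R}^n)$ with $\int_{\mathbb{R}^n}\Phi(k|f|)<\infty$ for some $k>0$, and $WL^\Phi(\mathbb{R}^n)$ the set of $f\in L^1_{\rm loc}(\mathbb{R}^n)$ with $\|f\|_{WL^\Phi}<\infty$;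 the local spaces $L^\Phi_{\rm loc}$, $WL^\Phi_{\rm loc}$ consist of the $f$ with $f\chi_B$ in $L^\Phi$, respectively $WL^\Phi$, for every ball $B$. For a positive measurable function $\varphi$ on $\mathbb{R}^n\times(0,\infty)$, $\mathcal{M}^{\Phi,\varphi}(\mathbb{R}^n)$ is the space of $f\in L^\Phi_{\rm loc}(\mathbb{R}^n)$ with $$\|f\|_{\mathcal{M}^{\Phi,\varphi}}=\sup_{x\in\mathbb{R}^n,\,r>0}\varphi(x,r)^{-1}\,\Phi^{-1}(|B(x,r)|^{-1})\,\|f\chi_{B(x,r)}\|_{L^\Phi}<\infty,$$ and $W\mathcal{M}^{\Phi,\varphi}(\mathbb{R}^n)$ is the space of $f\in WL^\Phi_{\rm loc}(\mathbb{R}^n)$ with $$\|f\|_{W\mathcal{M}^{\Phi,\varphi}}=\sup_{x\in\mathbb{R}^n,\,r>0}\varphi(x,r)^{-1}\,\Phi^{-1}(|B(x,r)|^{-1})\,\|f\chi_{B(x,r)}\|_{WL^\Phi}<\infty.$$ $\Omega_\Phi$ is the set of positive measurable functions $\varphi$ on $\mathbb{R}^n\times(0,\infty)$ such that, for all $t>0$,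 $$\sup_{x\in\mathbb{R}^n}\Big\|\frac{\Phi^{-1}(|B(x,\cdot)|^{-1})}{\varphi(x,\cdot)}\Big\|_{L^\infty(t,\infty)}<\infty\quad\text{and}\quad\sup_{x\in\mathbb{R}^n}\big\|\varphi(x,\cdot)^{-1}\big\|_{L^\infty(0,t)}<\infty.$$ The fractional maximal operator is $M_\alpha f(x)=\sup_{t>0}|B(x,t)|^{-1+\frac{\alpha}{n}}\int_{B(x,t)}|f(y)|\,dy$. Theorem. Let $0<\alpha<n$, $\beta\in(0,1)$, $\Phi\in\Delta'$ and $\varphi\in\Omega_\Phi$. Suppose that there is a constant $C<\infty$ such that for all $x\in\mathbb{R}^n$ and $r>0$ $$\sup_{r<t<\infty}\Phi^{-1}\big(|B(x,t)|^{-1}\big)\,\operatorname*{ess\,inf}_{t<s<\infty}\frac{\varphi(x,s)}{\Phi^{-1}(|B(x,s)|^{-1})}\le C\,\varphi(x,r)$$ and $$r^\alpha\varphi(x,r)+\sup_{r<t<\infty}t^\alpha\varphi(x,t)\le C\,\varphi(x,r)^\beta .$$ Define $\eta(x,t)=\varphi(x,t)^\beta$ and $\Psi(t)=\Phi(t^{1/\beta})$.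 Then $M_\alpha$ is bounded from $\mathcal{M}^{\Phi,\varphi}(\mathbb{R}^n)$ to $W\mathcal{M}^{\Psi,\eta}(\mathbb{R}^n)$: there is a constant $C'<\infty$ such that, for every $f\in\mathcal{M}^{\Phi,\varphi}(\mathbb{R}^n)$, $M_\alpha f\in W\mathcal{M}^{\Psi,\eta}(\mathbb{R}^n)$ and $\|M_\alpha f\|_{W\mathcal{M}^{\Psi,\eta}}\le C'\,\|f\|_{\mathcal{M}^{\Phi,\varphi}}$. -/

import Mathlib

open MeasureTheory Set Filter Topology
open scoped NNReal ENNReal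

noncomputable section

namespace OrliczMorrey

/-- Euclidean space `ℝⁿ`. -/
abbrev Eucl (n : ℕ) : Type := EuclideanSpace ℝ (Fin n)

/-- Young functions `Φ : [0,∞) → [0,∞]`. -/
structure IsYoung (Φ : ℝ≥0 → ℝ≥0∞) : Prop where
  convex : ConvexOn ℝ≥0 Set.univ Φ
  leftCont : ∀ r : ℝ≥0, ContinuousWithinAt Φ (Set.Iic r) r
  map_zero : Φ 0 = 0
  tendsto_zero : Tendsto Φ (𝓝[>] 0) (𝓝 0)
  tendsto_top : Tendsto Φ atTop (𝓝 ∞)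

/-- The `Δ'`-condition: `Φ (t r) ≤ C Φ(t) Φ(r)` for some `C > 1` and all `t, r ≥ 0`. -/
def DeltaPrime (Φ : ℝ≥0 → ℝ≥0∞) : Prop :=
  ∃ C : ℝ≥0, 1 < C ∧ ∀ t r : ℝ≥0, Φ (t * r) ≤ C * Φ t * Φ r

/-- `Φ⁻¹(s) = inf {r ≥ 0 : Φ(r) > s}` for `0 ≤ s ≤ ∞` (with `inf ∅ = ∞`). -/
def youngInv (Φ : ℝ≥0 → ℝ≥0∞) (s : ℝ≥0∞) : ℝ≥0∞ :=
  ⨅ (r : ℝ≥0) (_ : s < Φ r), (r : ℝ≥0∞)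

/-- `Φ⁻¹(|B(x,r)|⁻¹)`. -/
def invBall {n : ℕ} (Φ : ℝ≥0 → ℝ≥0∞) (x : Eucl n) (r : ℝ) : ℝ≥0∞ :=
  youngInv Φ (volume (Metric.ball x r))⁻¹

section Strong

variable {n : ℕ} {F : Type*} [NormedAddCommGroup F]

/-- The Luxemburg norm `‖f‖_{L^Φ}` (with `inf ∅ = ∞`). -/
def orliczNorm (Φ : ℝ≥0 → ℝ≥0∞) (f : Eucl n → F) : ℝ≥0∞ :=
  ⨅ (l : ℝ≥0) (_ : 0 < l ∧ ∫⁻ x, Φ (‖f x‖₊ / l) ≤ 1), (l : ℝ≥0∞)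

/-- `f ∈ L^Φ(ℝⁿ)`. -/
def MemOrlicz (Φ : ℝ≥0 → ℝ≥0∞) (f : Eucl n → F) : Prop :=
  LocallyIntegrable f volume ∧ ∃ k : ℝ≥0, 0 < k ∧ ∫⁻ x, Φ (k * ‖f x‖₊) < ∞

/-- `f ∈ L^Φ_loc(ℝⁿ)`: `f χ_B ∈ L^Φ(ℝⁿ)` for all balls `B`. -/
def MemOrliczLoc (Φ : ℝ≥0 → ℝ≥0∞) (f : Eucl n → F) : Prop :=
  ∀ (x : Eucl n) (r : ℝ), 0 < r → MemOrlicz Φ ((Metric.ball x r).indicator f)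

/-- The norm of the generalized Orlicz-Morrey space `M^{Φ,φ}(ℝⁿ)`. -/
def orliczMorreyNorm (Φ : ℝ≥0 → ℝ≥0∞) (φ : Eucl n → ℝ → ℝ≥0) (f : Eucl n → F) : ℝ≥0∞ :=
  ⨆ (x : Eucl n) (r : ℝ) (_ : 0 < r),
    (φ x r : ℝ≥0∞)⁻¹ * invBall Φ x r * orliczNorm Φ ((Metric.ball x r).indicator f)

/-- `f ∈ M^{Φ,φ}(ℝⁿ)`. -/
def MemOrliczMorrey (Φ : ℝ≥0 → ℝ≥0∞) (φ : Eucl n → ℝ → ℝ≥0) (f : Eucl n → F) : Prop :=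
  MemOrliczLoc Φ f ∧ orliczMorreyNorm Φ φ f < ∞

/-- The fractional maximal function
`M_α f(x) = sup_{t>0} |B(x,t)|^{-1+α/n} ∫_{B(x,t)} |f(y)| dy`, with values in `[0,∞]`. -/
def fracMaximal (α : ℝ) (f : Eucl n → F) (x : Eucl n) : ℝ≥0∞ :=
  ⨆ (t : ℝ) (_ : 0 < t),
    (volume (Metric.ball x t)) ^ (-1 + α / (n : ℝ)) * ∫⁻ y in Metric.ball x t, ‖f y‖ₑ

end Strong

/-! The weak spaces are defined for functions with values in any `ε` with an extended norm, so
that they apply to scalar functions and, with `‖g x‖ₑ = g x`, to functions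
`g : ℝⁿ → [0,∞]` such as maximal functions. -/

section Weak

variable {n : ℕ} {ε : Type*} [TopologicalSpace ε] [ENormedAddMonoid ε]

/-- The weak quasinorm `‖f‖_{WL^Φ} = inf {l > 0 : sup_{t>0} Φ(t/l) |{|f| > t}| ≤ 1}`. -/
def weakOrliczNorm (Φ : ℝ≥0 → ℝ≥0∞) (f : Eucl n → ε) : ℝ≥0∞ :=
  ⨅ (l : ℝ≥0) (_ : 0 < l ∧
      ⨆ (t : ℝ≥0) (_ : 0 < t), Φ (t / l) * volume {x | (t : ℝ≥0∞) < ‖f x‖ₑ} ≤ 1),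
    (l : ℝ≥0∞)

/-- `f ∈ WL^Φ(ℝⁿ)`. For `[0,∞]`-valued `f`, local integrability means almost everywhere
measurable with locally finite integral; in particular `f` is then finite almost everywhere. -/
def MemWeakOrlicz (Φ : ℝ≥0 → ℝ≥0∞) (f : Eucl n → ε) : Prop :=
  LocallyIntegrable f volume ∧ weakOrliczNorm Φ f < ∞

/-- `f ∈ WL^Φ_loc(ℝⁿ)`: `f χ_B ∈ WL^Φ(ℝⁿ)` for all balls `B`. -/
def MemWeakOrliczLoc (Φ : ℝ≥0 → ℝ≥0∞) (f : Eucl n → ε) : Prop :=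
  ∀ (x : Eucl n) (r : ℝ), 0 < r → MemWeakOrlicz Φ ((Metric.ball x r).indicator f)

/-- The quasinorm of the weak generalized Orlicz-Morrey space `WM^{Φ,φ}(ℝⁿ)`. -/
def weakOrliczMorreyNorm (Φ : ℝ≥0 → ℝ≥0∞) (φ : Eucl n → ℝ → ℝ≥0) (f : Eucl n → ε) : ℝ≥0∞ :=
  ⨆ (x : Eucl n) (r : ℝ) (_ : 0 < r),
    (φ x r : ℝ≥0∞)⁻¹ * invBall Φ x r * weakOrliczNorm Φ ((Metric.ball x r).indicator f)

/-- `f ∈ WM^{Φ,φ}(ℝⁿ)`. -/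
def MemWeakOrliczMorrey (Φ : ℝ≥0 → ℝ≥0∞) (φ : Eucl n → ℝ → ℝ≥0) (f : Eucl n → ε) : Prop :=
  MemWeakOrliczLoc Φ f ∧ weakOrliczMorreyNorm Φ φ f < ∞

end Weak

/-- The class `Ω_Φ` of positive (Lebesgue) measurable functions on `ℝⁿ × (0,∞)` with
`sup_x ‖Φ⁻¹(|B(x,·)|⁻¹)/φ(x,·)‖_{L^∞(t,∞)} < ∞` and `sup_x ‖φ(x,·)⁻¹‖_{L^∞(0,t)} < ∞` for
all `t > 0`. The values of `φ x r` at `r ≤ 0` play no role anywhere. -/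
structure MemOmega {n : ℕ} (Φ : ℝ≥0 → ℝ≥0∞) (φ : Eucl n → ℝ → ℝ≥0) : Prop where
  pos : ∀ (x : Eucl n) (r : ℝ), 0 < r → 0 < φ x r
  aemeasurable : AEMeasurable (fun p : Eucl n × ℝ => φ p.1 p.2)
    (volume.restrict (Set.univ ×ˢ Set.Ioi (0 : ℝ)))
  bound_infty : ∀ t : ℝ, 0 < t →
    ⨆ x : Eucl n, essSup (fun r : ℝ => invBall Φ x r / (φ x r : ℝ≥0∞))
      (volume.restrict (Set.Ioi t)) < ∞
  bound_zero : ∀ t : ℝ, 0 < t →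
    ⨆ x : Eucl n, essSup (fun r : ℝ => (φ x r : ℝ≥0∞)⁻¹)
      (volume.restrict (Set.Ioo 0 t)) < ∞

/-- `sup_{r<t<∞} Φ⁻¹(|B(x,t)|⁻¹) ess inf_{t<s<∞} φ(x,s)/Φ⁻¹(|B(x,s)|⁻¹) ≤ C φ(x,r)`,
with `C` independent of `x` and `r`. -/
def MaximalCondition {n : ℕ} (Φ : ℝ≥0 → ℝ≥0∞) (φ : Eucl n → ℝ → ℝ≥0) : Prop :=
  ∃ C : ℝ≥0, ∀ (x : Eucl n) (r : ℝ), 0 < r →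
    ⨆ (t : ℝ) (_ : r < t), invBall Φ x t *
      essInf (fun s : ℝ => (φ x s : ℝ≥0∞) / invBall Φ x s) (volume.restrict (Set.Ioi t))
      ≤ C * φ x r

/-- `r^α φ(x,r) + sup_{r<t<∞} t^α φ(x,t) ≤ C φ(x,r)^β`, with `C` independent of `x` and `r`. -/
def AdamsCondition {n : ℕ} (α β : ℝ) (φ : Eucl n → ℝ → ℝ≥0) : Prop :=
  ∃ C : ℝ≥0, ∀ (x : Eucl n) (r : ℝ), 0 < r →
    ENNReal.ofReal (r ^ α) * φ x r +
        ⨆ (t : ℝ) (_ : r < t), ENNReal.ofReal (t ^ α) * (φ x t : ℝ≥0∞)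
      ≤ C * ((φ x r ^ β : ℝ≥0) : ℝ≥0∞)

end OrliczMorrey

end

/-! The argument is Hedberg's: dominate `fracMaximal α f` pointwise by a power of `maximal f`, then
transfer a weak bound for `maximal f`.

Let N bound the Orlicz-Morrey norm of f, and let A be the average of |f| over B(x,t). Then A ≤
`maximal f x`, and Hölder gives A ≤ 2Nφ(x,t). Writing A = A^(1-β) A^β, the factor t^α φ(x,t)^(1-β)
is bounded by the Adams condition, so the fractional maximal function is at most a constant times
N^(1-β) (maximal f)^β (`exists_fracMaximal_le`).

For `maximal f` on B(x₀,r), f is split at B(x₀,2r) (`exists_weak_maximal_bound`). The inner part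
obeys a weak modular inequality, obtained from the Vitali covering argument applied to Φ(|f|/l). The
outer part is seen only by radii t > r, for which B(x,t) ⊆ B(x₀,2t), so the maximal condition bounds
its averages by a multiple of Nφ(x₀,r).

Raising levels to the power β turns Φ into Ψ and φ into η, and N^(1-β) N^β = N restores homogeneity.
Membership also needs local integrability: Ψ grows at least like t^(1/β) with 1/β > 1, so weak
bounds on balls imply integrability (`IsYoung.setLIntegral_lt_top`). -/

namespace OrliczMorrey

/-! ### Young functions and their generalized inverses -/

section Young

variable {Φ : ℝ≥0 → ℝ≥0∞}

/-- Convexity on the segment from 0 to m u, with Φ 0 = 0. Convexity enters the proof only in this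
form. -/
lemma IsYoung.mul_le (hΦ : IsYoung Φ) {m : ℝ≥0} (hm : 1 ≤ m) (u : ℝ≥0) :
    (m : ℝ≥0∞) * Φ u ≤ Φ (m * u) := by
  have hm0 : m ≠ 0 := (zero_lt_one.trans_le hm).ne'
  have h := hΦ.convex.2 (mem_univ (m * u)) (mem_univ 0) (zero_le (a := m⁻¹))
    (zero_le (a := 1 - m⁻¹)) (add_tsub_cancel_of_le (inv_le_one_of_one_le₀ hm))
  simp only [smul_zero, mul_zero, add_zero, hΦ.map_zero, smul_eq_mul, inv_mul_cancel_left₀ hm0] at h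
  calc (m : ℝ≥0∞) * Φ u ≤ m * (m⁻¹ • Φ (m * u)) := by gcongr
    _ = Φ (m * u) := by
      rw [ENNReal.smul_def, smul_eq_mul, ← mul_assoc, ← ENNReal.coe_mul, mul_inv_cancel₀ hm0,
        ENNReal.coe_one, one_mul]

lemma IsYoung.mono (hΦ : IsYoung Φ) : Monotone Φ := by
  intro u v huv
  rcases eq_or_ne u 0 with rfl | hu
  · simp [hΦ.map_zero]
  have h1 : 1 ≤ v / u := by rwa [one_le_div₀ (pos_iff_ne_zero.2 hu)]
  calc Φ u = (1 : ℝ≥0) * Φ u := by simp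
    _ ≤ (v / u : ℝ≥0) * Φ u := by gcongr
    _ ≤ Φ (v / u * u) := hΦ.mul_le h1 u
    _ = Φ v := by rw [div_mul_cancel₀ v hu]

lemma IsYoung.pos_of_ne_zero (hΦ : IsYoung Φ) {u : ℝ≥0} (hu : Φ u ≠ 0) : 0 < u := by
  rw [pos_iff_ne_zero]
  rintro rfl
  exact hu hΦ.map_zero

/-- The first term covers v ≤ u; beyond u the ratio Φ(v)/v is at least Φ(u)/u, which gives the
second. -/
lemma IsYoung.le_add_mul (hΦ : IsYoung Φ) {u : ℝ≥0} (h0 : Φ u ≠ 0) (h1 : Φ u ≠ ∞) (v : ℝ≥0) :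
    (v : ℝ≥0∞) ≤ u + u / Φ u * Φ v := by
  have hu := hΦ.pos_of_ne_zero h0
  rcases le_total v u with h | h
  · exact le_add_right (by exact_mod_cast h)
  · refine le_add_left ?_
    have h2 : 1 ≤ v / u := by rwa [one_le_div₀ hu]
    have h3 := hΦ.mul_le h2 u
    rw [div_mul_cancel₀ v hu.ne'] at h3
    calc (v : ℝ≥0∞) = u / Φ u * ((v / u : ℝ≥0) * Φ u) := by
          rw [ENNReal.div_eq_inv_mul, mul_comm ((v / u : ℝ≥0) : ℝ≥0∞), mul_assoc,
            mul_left_comm, ENNReal.inv_mul_cancel_left h0 h1, ← ENNReal.coe_mul,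
            mul_div_cancel₀ v hu.ne']
      _ ≤ _ := by gcongr

/-- A substitute for Jensen's inequality. -/
lemma IsYoung.lintegral_le {X : Type*} [MeasurableSpace X] {μ : Measure X} (hΦ : IsYoung Φ)
    {v : X → ℝ≥0} (hv : AEMeasurable v μ) {u : ℝ≥0} (hu : Φ u ≠ 0)
    (hfin : ∫⁻ x, Φ (v x) ∂μ ≠ ∞) :
    ∫⁻ x, v x ∂μ ≤ u * μ univ + u / Φ u * ∫⁻ x, Φ (v x) ∂μ := by
  rcases eq_or_ne (Φ u) ∞ with h | h
  -- Here u / Φ u = 0, so v ≤ u must hold almost everywhere; finiteness of the modular forces it.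
  · have hae : ∀ᵐ x ∂μ, Φ (v x) < ∞ :=
      ae_lt_top' (hΦ.mono.measurable.comp_aemeasurable hv) hfin
    refine le_add_right ?_
    rw [← lintegral_const]
    refine lintegral_mono_ae ?_
    filter_upwards [hae] with x hx
    by_contra! hlt
    have h2 := hΦ.mono (ENNReal.coe_le_coe.1 hlt.le)
    exact (h2.trans_lt hx).ne h
  · calc ∫⁻ x, v x ∂μ ≤ ∫⁻ x, (u + u / Φ u * Φ (v x)) ∂μ :=
          lintegral_mono fun x => hΦ.le_add_mul hu h (v x)
      _ = _ := by
          rw [lintegral_add_left measurable_const, lintegral_const, lintegral_const_mul']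
          exact ENNReal.div_ne_top ENNReal.coe_ne_top hu

lemma le_of_lt_youngInv {s : ℝ≥0∞} {u : ℝ≥0} (h : (u : ℝ≥0∞) < youngInv Φ s) : Φ u ≤ s := by
  by_contra! hlt
  exact (h.trans_le (iInf₂_le u hlt)).false

lemma IsYoung.youngInv_ne_top (hΦ : IsYoung Φ) {s : ℝ≥0∞} (hs : s ≠ ∞) : youngInv Φ s ≠ ∞ := by
  obtain ⟨u, hu⟩ := (hΦ.tendsto_top.eventually (lt_mem_nhds (lt_top_iff_ne_top.2 hs))).exists
  exact ((iInf₂_le u hu).trans_lt ENNReal.coe_lt_top).ne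

lemma IsYoung.youngInv_ne_zero (hΦ : IsYoung Φ) {s : ℝ≥0∞} (hs : s ≠ 0) : youngInv Φ s ≠ 0 := by
  have h := (hΦ.tendsto_zero.eventually (gt_mem_nhds (pos_iff_ne_zero.2 hs))).and
    self_mem_nhdsWithin
  obtain ⟨u, hu, hu0⟩ := h.exists
  have hu0 : 0 < u := hu0
  refine (lt_of_lt_of_le (ENNReal.coe_pos.2 hu0) (le_iInf₂ fun r hr => ?_)).ne'
  by_contra! hlt
  exact (hr.trans_le (hΦ.mono (ENNReal.coe_le_coe.1 hlt.le))).not_gt hu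

lemma IsYoung.youngInv_le_mul (hΦ : IsYoung Φ) {m : ℝ≥0} (hm : 1 ≤ m) (s : ℝ≥0∞) :
    youngInv Φ (m * s) ≤ m * youngInv Φ s := by
  have hm0 : m ≠ 0 := (zero_lt_one.trans_le hm).ne'
  rw [youngInv, youngInv, ENNReal.mul_iInf_of_ne (by simpa) ENNReal.coe_ne_top]
  refine le_iInf fun u => ?_
  rw [ENNReal.mul_iInf_of_ne (by simpa) ENNReal.coe_ne_top]
  refine le_iInf fun hu => ?_
  have h : m * s < Φ (m * u) := lt_of_lt_of_le
    ((ENNReal.mul_lt_mul_iff_right (by simpa) ENNReal.coe_ne_top).2 hu) (hΦ.mul_le hm u)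
  rw [← ENNReal.coe_mul]
  exact iInf₂_le (m * u) h

/-- Each u admissible for Φ yields u^β admissible for Ψ. An upper bound suffices, since the inverse
of Ψ is a factor of the norm to be estimated. -/
lemma youngInv_rpow_le {Ψ : ℝ≥0 → ℝ≥0∞} {β : ℝ} (hβ : 0 < β)
    (hΨ : ∀ t, Ψ t = Φ (t ^ (1 / β))) (s : ℝ≥0∞) : youngInv Ψ s ≤ youngInv Φ s ^ β := by
  rw [← ENNReal.rpow_le_rpow_iff (one_div_pos.2 hβ), ← ENNReal.rpow_mul,
    mul_one_div_cancel hβ.ne', ENNReal.rpow_one]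
  refine le_iInf₂ fun u hu => ?_
  have h : youngInv Ψ s ≤ ((u ^ β : ℝ≥0) : ℝ≥0∞) := by
    refine iInf₂_le _ ?_
    rwa [hΨ, ← NNReal.rpow_mul, mul_one_div_cancel hβ.ne', NNReal.rpow_one]
  calc youngInv Ψ s ^ (1 / β) ≤ ((u ^ β : ℝ≥0) : ℝ≥0∞) ^ (1 / β) := by gcongr
    _ = u := by
      rw [← ENNReal.coe_rpow_of_nonneg _ (one_div_pos.2 hβ).le, ← NNReal.rpow_mul,
        mul_one_div_cancel hβ.ne', NNReal.rpow_one]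

end Young

/-! ### Volumes of balls and the Vitali covering argument -/

section Ball

variable {n : ℕ}

lemma volume_ball_mul (x y : Eucl n) {c r : ℝ} (hc : 0 < c) :
    volume (Metric.ball x (c * r)) = ENNReal.ofReal (c ^ n) * volume (Metric.ball y r) := by
  rw [Measure.addHaar_ball_mul_of_pos volume x hc, finrank_euclideanSpace_fin,
    Measure.addHaar_ball_center volume y r]

lemma volume_ball_ne_zero (x : Eucl n) {r : ℝ} (hr : 0 < r) : volume (Metric.ball x r) ≠ 0 :=
  (Metric.measure_ball_pos volume x hr).ne'

lemma volume_ball_ne_top (x : Eucl n) (r : ℝ) : volume (Metric.ball x r) ≠ ∞ :=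
  measure_ball_lt_top.ne

/-- The weak type `(1,1)` inequality for the centered maximal operator. -/
lemma mul_volume_setOf_lt_lintegral_ball_le (hn : n ≠ 0) (g : Eucl n → ℝ≥0∞) {c : ℝ≥0∞}
    (hc0 : c ≠ 0) (hg : ∫⁻ x, g x ≠ ∞) :
    c * volume {x | ∃ t : ℝ, 0 < t ∧
      c * volume (Metric.ball x t) < ∫⁻ y in Metric.ball x t, g y} ≤ 5 ^ n * ∫⁻ x, g x := by
  have : Nontrivial (Eucl n) := by
    have : Nonempty (Fin n) := ⟨⟨0, Nat.pos_of_ne_zero hn⟩⟩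
    infer_instance
  set T : Set (Eucl n × ℝ) := {p | 0 < p.2 ∧
      c * volume (Metric.ball p.1 p.2) < ∫⁻ y in Metric.ball p.1 p.2, g y} with hT
  -- Vitali needs bounded radii: c |B| < ∫ g bounds t^n, and t ≤ t^n once t > 1.
  obtain ⟨R, hR⟩ : ∃ R : ℝ, ∀ p ∈ T, p.2 ≤ R := by
    have hv0 := volume_ball_ne_zero (0 : Eucl n) zero_lt_one
    set v := volume (Metric.ball (0 : Eucl n) 1)
    have hcv : c * v ≠ 0 := mul_ne_zero hc0 hv0
    refine ⟨max 1 ((∫⁻ x, g x) / (c * v)).toReal, fun p hp => ?_⟩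
    rcases le_or_gt p.2 1 with h1 | h1
    · exact h1.trans (le_max_left _ _)
    refine le_trans ?_ (le_max_right _ _)
    have hfin : (∫⁻ x, g x) / (c * v) ≠ ∞ := ENNReal.div_ne_top hg hcv
    rw [← ENNReal.ofReal_le_iff_le_toReal hfin]
    have h2 : c * v * ENNReal.ofReal p.2 ≤ ∫⁻ x, g x := by
      refine le_trans ?_ (hp.2.le.trans (setLIntegral_le_lintegral _ _))
      have h3 := volume_ball_mul p.1 (0 : Eucl n) (r := 1) hp.1
      rw [mul_one] at h3
      rw [h3, mul_assoc, mul_comm v]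
      gcongr
      exact le_self_pow₀ h1.le hn
    -- The value c = ∞ has to be allowed, because c will be Φ u.
    rcases eq_or_ne (c * v) ∞ with h4 | h4
    · rw [h4, ENNReal.top_mul (by simpa using hp.1)] at h2
      exact absurd (top_le_iff.1 h2) hg
    · rwa [ENNReal.le_div_iff_mul_le (Or.inl hcv) (Or.inl h4), mul_comm]
  obtain ⟨u, huT, hdisj, hcov⟩ := Vitali.exists_disjoint_subfamily_covering_enlargement_closedBall
    T (fun p => p.1) (fun p => p.2) R hR 5 (by norm_num)
  have hcount : u.Countable := hdisj.countable_of_nonempty_interior fun p hp => by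
    have h0 : 0 < p.2 := (huT hp).1
    refine ⟨p.1, ?_⟩
    rw [mem_interior]
    exact ⟨_, Metric.ball_subset_closedBall, Metric.isOpen_ball, Metric.mem_ball_self h0⟩
  have hsub : {x | ∃ t : ℝ, 0 < t ∧
      c * volume (Metric.ball x t) < ∫⁻ y in Metric.ball x t, g y} ⊆
      ⋃ p ∈ u, Metric.closedBall p.1 (5 * p.2) := by
    rintro x ⟨t, ht, hx⟩
    obtain ⟨p, hp, hsubp⟩ := hcov (x, t) ⟨ht, hx⟩
    exact mem_iUnion₂.2 ⟨p, hp, hsubp (Metric.mem_closedBall_self ht.le)⟩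
  have := hcount.to_subtype
  calc _ ≤ c * ∑' p : u, volume (Metric.closedBall p.1.1 (5 * p.1.2)) := by
        gcongr
        exact (measure_mono hsub).trans (measure_biUnion_le _ hcount _)
    _ = ∑' p : u, 5 ^ n * (c * volume (Metric.ball p.1.1 p.1.2)) := by
        rw [← ENNReal.tsum_mul_left]
        refine tsum_congr fun p => ?_
        rw [Measure.addHaar_closedBall_eq_addHaar_ball,
          volume_ball_mul p.1.1 p.1.1 (by norm_num : (0 : ℝ) < 5),
          ENNReal.ofReal_pow (by norm_num)]
        simp only [ENNReal.ofReal_ofNat]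
        ring
    _ ≤ ∑' p : u, 5 ^ n * ∫⁻ y in Metric.closedBall p.1.1 p.1.2, g y := by
        refine ENNReal.tsum_le_tsum fun p => ?_
        gcongr
        exact (huT p.2).2.le.trans (lintegral_mono_set Metric.ball_subset_closedBall)
    _ = 5 ^ n * ∫⁻ y in ⋃ p ∈ u, Metric.closedBall p.1 p.2, g y := by
        rw [ENNReal.tsum_mul_left, lintegral_biUnion hcount
          (fun p _ => Metric.isClosed_closedBall.measurableSet) hdisj]
    _ ≤ 5 ^ n * ∫⁻ x, g x := by
        gcongr 5 ^ n * ?_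
        exact setLIntegral_le_lintegral _ _

end Ball

/-! ### Hölder's inequality and Orlicz-Morrey norms on balls -/

section Orlicz

variable {n : ℕ} {F : Type*} [NormedAddCommGroup F] {Φ : ℝ≥0 → ℝ≥0∞} {f : Eucl n → F}

lemma MemOrliczLoc.locallyIntegrable (hf : MemOrliczLoc Φ f) : LocallyIntegrable f volume := by
  intro x
  obtain ⟨s, hs, hint⟩ := (hf x 1 one_pos).1 x
  refine ⟨s ∩ Metric.ball x 1, inter_mem hs (Metric.ball_mem_nhds x one_pos), ?_⟩
  rwa [IntegrableOn, integrable_indicator_iff measurableSet_ball, IntegrableOn,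
    Measure.restrict_restrict measurableSet_ball, inter_comm] at hint

lemma IsYoung.orliczNorm_indicator_mono (hΦ : IsYoung Φ) {s t : Set (Eucl n)} (hst : s ⊆ t) :
    orliczNorm Φ (s.indicator f) ≤ orliczNorm Φ (t.indicator f) := by
  refine le_iInf₂ fun l hl => iInf₂_le l ⟨hl.1, le_trans (lintegral_mono fun x => ?_) hl.2⟩
  refine hΦ.mono (div_le_div_of_nonneg_right ?_ (zero_le (a := l)))
  exact norm_indicator_le_of_subset hst f x

lemma IsYoung.lintegral_le_one (hΦ : IsYoung Φ) {l : ℝ≥0} (hl : orliczNorm Φ f < l) :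
    ∫⁻ x, Φ (‖f x‖₊ / l) ≤ 1 := by
  rw [orliczNorm, iInf_lt_iff] at hl
  obtain ⟨k, hk⟩ := hl
  rw [iInf_lt_iff] at hk
  obtain ⟨⟨hk0, hk1⟩, hkl⟩ := hk
  refine le_trans (lintegral_mono fun x => hΦ.mono ?_) hk1
  exact div_le_div_of_nonneg_left (zero_le) hk0 (ENNReal.coe_le_coe.1 hkl.le)

/-- Hölder's inequality against the indicator of a set. -/
lemma IsYoung.setLIntegral_enorm_le (hΦ : IsYoung Φ) (hf : AEStronglyMeasurable f volume)
    {s : Set (Eucl n)} (hs : MeasurableSet s) (hs0 : volume s ≠ 0) (hs1 : volume s ≠ ∞) :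
    ∫⁻ x in s, ‖f x‖ₑ ≤
      2 * volume s * youngInv Φ (volume s)⁻¹ * orliczNorm Φ (s.indicator f) := by
  have hinv0 : youngInv Φ (volume s)⁻¹ ≠ 0 := hΦ.youngInv_ne_zero (ENNReal.inv_ne_zero.2 hs1)
  have hinv1 : youngInv Φ (volume s)⁻¹ ≠ ∞ := hΦ.youngInv_ne_top (ENNReal.inv_ne_top.2 hs0)
  have hc0 : 2 * volume s ≠ 0 := mul_ne_zero two_ne_zero hs0
  have hc1 : 2 * volume s ≠ ∞ := ENNReal.mul_ne_top ENNReal.ofNat_ne_top hs1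
  rw [orliczNorm, ENNReal.mul_iInf_of_ne (mul_ne_zero hc0 hinv0) (ENNReal.mul_ne_top hc1 hinv1)]
  refine le_iInf fun l => ?_
  rw [ENNReal.mul_iInf_of_ne (mul_ne_zero hc0 hinv0) (ENNReal.mul_ne_top hc1 hinv1)]
  refine le_iInf fun ⟨hl0, hl⟩ => ?_
  have hl0' : (l : ℝ≥0∞) ≠ 0 := by simpa using hl0.ne'
  have key : ∫⁻ x in s, ((‖f x‖₊ / l : ℝ≥0) : ℝ≥0∞) ≤
      2 * volume s * youngInv Φ (volume s)⁻¹ := by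
    -- It is enough to bound by each u with Φ u > 1/|s|; for such u both terms of the Jensen
    -- substitute are at most u |s|.
    rw [youngInv, ENNReal.mul_iInf_of_ne hc0 hc1]
    refine le_iInf fun u => ?_
    rw [ENNReal.mul_iInf_of_ne hc0 hc1]
    refine le_iInf fun hu => ?_
    have hu0 : Φ u ≠ 0 := (zero_le.trans_lt hu).ne'
    have hI : ∫⁻ x in s, Φ (‖f x‖₊ / l) ≤ 1 := by
      refine le_trans ?_ hl
      rw [← lintegral_indicator hs]
      refine lintegral_mono fun x => ?_
      by_cases hx : x ∈ s <;> simp [hx]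
    have h := hΦ.lintegral_le (μ := volume.restrict s) (v := fun x => ‖f x‖₊ / l)
      ((hf.nnnorm.aemeasurable.div_const l).restrict) hu0 (hI.trans_lt ENNReal.one_lt_top).ne
    rw [Measure.restrict_apply_univ] at h
    calc _ ≤ _ := h
      _ ≤ u * volume s + u * volume s := by
        gcongr u * volume s + ?_
        calc u / Φ u * ∫⁻ x in s, Φ (‖f x‖₊ / l) ≤ u / (volume s)⁻¹ * 1 := by gcongr
          _ = u * volume s := by rw [mul_one, div_eq_mul_inv, inv_inv]
      _ = 2 * volume s * u := by ring
  calc ∫⁻ x in s, ‖f x‖ₑ = ∫⁻ x in s, ((‖f x‖₊ / l : ℝ≥0) : ℝ≥0∞) * l := by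
        refine lintegral_congr fun x => ?_
        rw [← ENNReal.coe_mul, div_mul_cancel₀ _ hl0.ne', enorm_eq_nnnorm]
    _ = (∫⁻ x in s, ((‖f x‖₊ / l : ℝ≥0) : ℝ≥0∞)) * l := lintegral_mul_const' _ _ ENNReal.coe_ne_top
    _ ≤ _ := by gcongr

lemma IsYoung.invBall_ne_zero (hΦ : IsYoung Φ) (x : Eucl n) (r : ℝ) :
    invBall Φ x r ≠ 0 :=
  hΦ.youngInv_ne_zero (ENNReal.inv_ne_zero.2 (volume_ball_ne_top x r))

lemma IsYoung.invBall_ne_top (hΦ : IsYoung Φ) (x : Eucl n) {r : ℝ} (hr : 0 < r) :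
    invBall Φ x r ≠ ∞ :=
  hΦ.youngInv_ne_top (ENNReal.inv_ne_top.2 (volume_ball_ne_zero x hr))

lemma IsYoung.invBall_le_two_mul (hΦ : IsYoung Φ) (x : Eucl n) (r : ℝ) :
    invBall Φ x r ≤ 2 ^ n * invBall Φ x (2 * r) := by
  have h := hΦ.youngInv_le_mul (m := 2 ^ n) (one_le_pow₀ one_le_two)
    (volume (Metric.ball x (2 * r)))⁻¹
  have h2 : ((2 ^ n : ℝ≥0) : ℝ≥0∞) * (volume (Metric.ball x (2 * r)))⁻¹ =
      (volume (Metric.ball x r))⁻¹ := by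
    rw [volume_ball_mul x x two_pos, ENNReal.ofReal_pow two_pos.le, ENNReal.ofReal_ofNat,
      ENNReal.mul_inv (Or.inl (by simp)) (Or.inl (by simp)), ENNReal.coe_pow, ENNReal.coe_ofNat,
      ENNReal.mul_inv_cancel_left (by simp) (by simp)]
  rw [h2] at h
  simpa [invBall] using h

variable {φ : Eucl n → ℝ → ℝ≥0}

lemma invBall_mul_orliczNorm_le {N : ℝ≥0} (hN : orliczMorreyNorm Φ φ f ≤ N) (x : Eucl n) {r : ℝ}
    (hr : 0 < r) (hφ : 0 < φ x r) :
    invBall Φ x r * orliczNorm Φ ((Metric.ball x r).indicator f) ≤ N * φ x r := by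
  have h : (φ x r : ℝ≥0∞)⁻¹ * invBall Φ x r * orliczNorm Φ ((Metric.ball x r).indicator f) ≤ N :=
    le_trans (le_iSup_of_le x (le_iSup₂ (f := fun r (_ : 0 < r) => (φ x r : ℝ≥0∞)⁻¹ *
      invBall Φ x r * orliczNorm Φ ((Metric.ball x r).indicator f)) r hr)) hN
  rw [mul_assoc, ← ENNReal.div_eq_inv_mul] at h
  rwa [ENNReal.div_le_iff (by simpa using hφ.ne') ENNReal.coe_ne_top] at h

/-- For every s > t, enlarging the ball to B(x,s) bounds the Orlicz norm on B(x,t) by N φ(x,s) /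
Φ⁻¹(|B(x,s)|⁻¹). Hence it is at most N times the essential infimum in the maximal condition. -/
lemma invBall_mul_orliczNorm_le_of_lt (hΦ : IsYoung Φ) (hφ : ∀ x r, 0 < r → 0 < φ x r) {C : ℝ≥0}
    (hC : ∀ (x : Eucl n) (r : ℝ), 0 < r → ⨆ (t : ℝ) (_ : r < t), invBall Φ x t *
      essInf (fun s : ℝ => (φ x s : ℝ≥0∞) / invBall Φ x s) (volume.restrict (Set.Ioi t))
      ≤ C * φ x r) {N : ℝ≥0} (hN0 : 0 < N) (hN : orliczMorreyNorm Φ φ f ≤ N) (x : Eucl n)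
    {r t : ℝ} (hr : 0 < r) (hrt : r < t) :
    invBall Φ x t * orliczNorm Φ ((Metric.ball x t).indicator f) ≤ C * N * φ x r := by
  have hN0' : (N : ℝ≥0∞) ≠ 0 := by simpa using hN0.ne'
  have h1 : orliczNorm Φ ((Metric.ball x t).indicator f) / N ≤
      essInf (fun s : ℝ => (φ x s : ℝ≥0∞) / invBall Φ x s) (volume.restrict (Set.Ioi t)) := by
    refine le_essInf_of_ae_le _ ?_
    filter_upwards [ae_restrict_mem measurableSet_Ioi] with s hs
    have hs' : t < s := hs
    have hs0 : 0 < s := hr.trans (hrt.trans hs')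
    rw [ENNReal.div_le_iff hN0' ENNReal.coe_ne_top, ← ENNReal.mul_div_right_comm,
      ENNReal.le_div_iff_mul_le (Or.inl (hΦ.invBall_ne_zero x s))
        (Or.inl (hΦ.invBall_ne_top x hs0)), mul_comm (φ x s : ℝ≥0∞), mul_comm]
    refine le_trans ?_ (invBall_mul_orliczNorm_le hN x hs0 (hφ x s hs0))
    gcongr
    exact hΦ.orliczNorm_indicator_mono (Metric.ball_subset_ball hs'.le)
  have h2 := le_trans (le_iSup₂_of_le t hrt le_rfl) (hC x r hr)
  calc _ = invBall Φ x t * (orliczNorm Φ ((Metric.ball x t).indicator f) / N) * N := by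
        rw [mul_assoc, ENNReal.div_mul_cancel hN0' ENNReal.coe_ne_top]
    _ ≤ invBall Φ x t * essInf (fun s : ℝ => (φ x s : ℝ≥0∞) / invBall Φ x s)
          (volume.restrict (Set.Ioi t)) * N := by gcongr
    _ ≤ C * φ x r * N := by gcongr
    _ = _ := by ring

/-- Averages over `B(x,t)` of the part of `f` away from `B(x₀,2r)`, for `x ∈ B(x₀,r)`. -/
lemma setLIntegral_diff_ball_le (hΦ : IsYoung Φ) (hφ : ∀ x r, 0 < r → 0 < φ x r) {C : ℝ≥0}
    (hC : ∀ (x : Eucl n) (r : ℝ), 0 < r → ⨆ (t : ℝ) (_ : r < t), invBall Φ x t *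
      essInf (fun s : ℝ => (φ x s : ℝ≥0∞) / invBall Φ x s) (volume.restrict (Set.Ioi t))
      ≤ C * φ x r) {N : ℝ≥0} (hN0 : 0 < N) (hN : orliczMorreyNorm Φ φ f ≤ N)
    (hf : AEStronglyMeasurable f volume) {x₀ x : Eucl n} {r : ℝ} (hr : 0 < r)
    (hx : x ∈ Metric.ball x₀ r) (t : ℝ) :
    ∫⁻ y in Metric.ball x t \ Metric.ball x₀ (2 * r), ‖f y‖ₑ ≤
      2 * 2 ^ n * C * N * φ x₀ r * volume (Metric.ball x t) := by
  rw [Metric.mem_ball] at hx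
  rcases (Metric.ball x t \ Metric.ball x₀ (2 * r)).eq_empty_or_nonempty with he | ⟨z, hz, hz'⟩
  · simp [he]
  rw [Metric.mem_ball] at hz hz'
  -- A point z of the difference has |z - x₀| ≥ 2r, while |x - x₀| < r; hence t > r.
  have htri := dist_triangle z x x₀
  have hrt : r < t := by linarith
  have ht : 0 < t := hr.trans hrt
  have hsub : Metric.ball x t ⊆ Metric.ball x₀ (2 * t) :=
    Metric.ball_subset_ball' (by linarith)
  calc _ ≤ ∫⁻ y in Metric.ball x₀ (2 * t), ‖f y‖ₑ := lintegral_mono_set (sdiff_subset.trans hsub)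
    _ ≤ 2 * volume (Metric.ball x₀ (2 * t)) * invBall Φ x₀ (2 * t) *
          orliczNorm Φ ((Metric.ball x₀ (2 * t)).indicator f) :=
        hΦ.setLIntegral_enorm_le hf measurableSet_ball (volume_ball_ne_zero _ (by positivity))
          (volume_ball_ne_top _ _)
    _ ≤ 2 * volume (Metric.ball x₀ (2 * t)) * (C * N * φ x₀ r) := by
        rw [mul_assoc]
        gcongr 2 * volume (Metric.ball x₀ (2 * t)) * ?_
        exact invBall_mul_orliczNorm_le_of_lt hΦ hφ hC hN0 hN x₀ hr (by linarith)
    _ = _ := by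
        rw [volume_ball_mul x₀ x two_pos, ENNReal.ofReal_pow two_pos.le, ENNReal.ofReal_ofNat]
        ring

end Orlicz

/-- The centered Hardy-Littlewood maximal function. -/
noncomputable def maximal {n : ℕ} {F : Type*} [NormedAddCommGroup F] (f : Eucl n → F) (x : Eucl n) : ℝ≥0∞ :=
  ⨆ (t : ℝ) (_ : 0 < t), (volume (Metric.ball x t))⁻¹ * ∫⁻ y in Metric.ball x t, ‖f y‖ₑ

/-! ### Weak estimates for the Hardy-Littlewood maximal function -/

section Maximal

variable {n : ℕ} {F : Type*} [NormedAddCommGroup F] {Φ : ℝ≥0 → ℝ≥0∞} {f : Eucl n → F}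

lemma lt_maximal_iff {c : ℝ≥0∞} {x : Eucl n} : c < maximal f x ↔ ∃ t : ℝ, 0 < t ∧
    c * volume (Metric.ball x t) < ∫⁻ y in Metric.ball x t, ‖f y‖ₑ := by
  simp only [maximal, lt_iSup_iff, exists_prop]
  refine exists_congr fun t => and_congr_right fun ht => ?_
  rw [← ENNReal.div_eq_inv_mul, ENNReal.lt_div_iff_mul_lt (Or.inl (volume_ball_ne_zero x ht))
    (Or.inl (volume_ball_ne_top x t))]

/-- The weak type modular inequality for the maximal function on `L^Φ`. -/
lemma IsYoung.mul_volume_setOf_lt_le (hΦ : IsYoung Φ) (hn : n ≠ 0)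
    (hf : AEStronglyMeasurable f volume) {l : ℝ≥0} (hl : 0 < l)
    (hI : ∫⁻ x, Φ (‖f x‖₊ / l) ≤ 1) (u : ℝ≥0) :
    Φ u * volume {x | 2 * u * l < maximal f x} ≤ 5 ^ n := by
  rcases eq_or_ne (Φ u) 0 with hu | hu
  · simp [hu]
  have hu0 := hΦ.pos_of_ne_zero hu
  have hl0 : (l : ℝ≥0∞) ≠ 0 := by simpa using hl.ne'
  calc _ ≤ Φ u * volume {x | ∃ t : ℝ, 0 < t ∧ Φ u * volume (Metric.ball x t) <
          ∫⁻ y in Metric.ball x t, Φ (‖f y‖₊ / l)} := by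
        gcongr with x
        rw [lt_maximal_iff]
        rintro ⟨t, ht, h⟩
        refine ⟨t, ht, ?_⟩
        -- If Φ(|f|/l) had average at most Φ u on the ball, the Jensen substitute would give |f|
        -- average at most 2 u l.
        by_contra! hle
        refine h.not_ge ?_
        have h1 := hΦ.lintegral_le (μ := volume.restrict (Metric.ball x t))
          (v := fun y => ‖f y‖₊ / l) ((hf.nnnorm.aemeasurable.div_const l).restrict) hu
          (((setLIntegral_le_lintegral _ _).trans hI).trans_lt ENNReal.one_lt_top).ne
        rw [Measure.restrict_apply_univ] at h1
        have h2 : u / Φ u * ∫⁻ y in Metric.ball x t, Φ (‖f y‖₊ / l) ≤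
            u * volume (Metric.ball x t) := by
          calc _ ≤ u / Φ u * (Φ u * volume (Metric.ball x t)) := by gcongr
            _ = Φ u * (u / Φ u) * volume (Metric.ball x t) := by ring
            _ ≤ _ := by gcongr; exact ENNReal.mul_div_le
        calc ∫⁻ y in Metric.ball x t, ‖f y‖ₑ
            = ∫⁻ y in Metric.ball x t, ((‖f y‖₊ / l : ℝ≥0) : ℝ≥0∞) * l := by
              refine lintegral_congr fun x => ?_
              rw [← ENNReal.coe_mul, div_mul_cancel₀ _ hl.ne', enorm_eq_nnnorm]
          _ = (∫⁻ y in Metric.ball x t, ((‖f y‖₊ / l : ℝ≥0) : ℝ≥0∞)) * l :=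
              lintegral_mul_const' _ _ ENNReal.coe_ne_top
          _ ≤ (u * volume (Metric.ball x t) + u * volume (Metric.ball x t)) * l := by
              gcongr
              exact h1.trans (by gcongr)
          _ = _ := by ring
    _ ≤ 5 ^ n * ∫⁻ x, Φ (‖f x‖₊ / l) :=
        mul_volume_setOf_lt_lintegral_ball_le hn _ hu (hI.trans_lt ENNReal.one_lt_top).ne
    _ ≤ 5 ^ n * 1 := by gcongr
    _ = 5 ^ n := mul_one _

lemma maximal_le_maximal_indicator_add {s : Set (Eucl n)} (hs : MeasurableSet s) {x : Eucl n}
    {K : ℝ≥0∞} (hK : ∀ t, ∫⁻ y in Metric.ball x t \ s, ‖f y‖ₑ ≤ K * volume (Metric.ball x t)) :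
    maximal f x ≤ maximal (s.indicator f) x + K := by
  refine iSup₂_le fun t ht => ?_
  have h0 := volume_ball_ne_zero x ht
  calc _ = (volume (Metric.ball x t))⁻¹ * ((∫⁻ y in Metric.ball x t ∩ s, ‖f y‖ₑ) +
          ∫⁻ y in Metric.ball x t \ s, ‖f y‖ₑ) := by rw [lintegral_inter_add_sdiff _ _ hs]
    _ ≤ (volume (Metric.ball x t))⁻¹ * ((∫⁻ y in Metric.ball x t, ‖s.indicator f y‖ₑ) +
          K * volume (Metric.ball x t)) := by
        gcongr _ * (?_ + ?_)
        · simp_rw [enorm_indicator_eq_indicator_enorm]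
          rw [lintegral_indicator hs, Measure.restrict_restrict hs, inter_comm]
        · exact hK t
    _ ≤ _ := by
        rw [mul_add]
        gcongr
        · exact le_iSup₂ (f := fun t (_ : 0 < t) => (volume (Metric.ball x t))⁻¹ *
            ∫⁻ y in Metric.ball x t, ‖s.indicator f y‖ₑ) t ht
        · rw [mul_comm K, ENNReal.inv_mul_cancel_left h0 (volume_ball_ne_top x t)]

variable {φ : Eucl n → ℝ → ℝ≥0}

/-- The maximal operator is bounded from `M^{Φ,φ}` to `WM^{Φ,φ}`. -/
lemma exists_weak_maximal_bound (hn : n ≠ 0) (hΦ : IsYoung Φ)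
    (hφ : ∀ x r, 0 < r → 0 < φ x r) (hmax : MaximalCondition Φ φ) :
    ∃ C : ℝ≥0, 0 < C ∧ ∀ f : Eucl n → F, AEStronglyMeasurable f volume → ∀ N : ℝ≥0,
      orliczMorreyNorm Φ φ f < N → ∀ (x : Eucl n) (r : ℝ), 0 < r → ∀ t : ℝ≥0,
        Φ (t / (C * N * φ x r / (invBall Φ x r).toNNReal)) *
          volume {y ∈ Metric.ball x r | (t : ℝ≥0∞) < maximal f y} ≤ 1 := by
  obtain ⟨C, hC⟩ := hmax
  -- The factor 5^n absorbs the Vitali constant through convexity, 2^n comes from doubling, and the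
  -- added 1 makes the Orlicz norm of the inner part strictly less than l. With 8, the threshold t ≤
  -- 4 l a leaves the strict inequality needed below the generalized inverse.
  refine ⟨8 * 5 ^ n * (2 ^ n * C + 1), by positivity, fun f hf N hN x r hr t => ?_⟩
  have hN0 : 0 < N := ENNReal.coe_pos.1 (zero_le.trans_lt hN)
  have hφ0 := hφ x r hr
  set a : ℝ≥0 := (invBall Φ x r).toNNReal with ha
  have ha' : (a : ℝ≥0∞) = invBall Φ x r := ENNReal.coe_toNNReal (hΦ.invBall_ne_top x hr)
  have ha0 : 0 < a := by
    rw [← ENNReal.coe_pos, ha', pos_iff_ne_zero]; exact hΦ.invBall_ne_zero x r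
  set l : ℝ≥0 := (2 ^ n * C + 1) * N * φ x r / a with hl
  have hl0 : 0 < l := by positivity
  have hla : l * a = (2 ^ n * C + 1) * N * φ x r := div_mul_cancel₀ _ ha0.ne'
  have hl' : 8 * 5 ^ n * (2 ^ n * C + 1) * N * φ x r / a = 8 * 5 ^ n * l := by
    rw [hl]; ring
  rw [hl']
  set s := Metric.ball x (2 * r) with hs
  have hI : ∫⁻ y, Φ (‖s.indicator f y‖₊ / l) ≤ 1 := by
    refine hΦ.lintegral_le_one ?_
    have h1 := invBall_mul_orliczNorm_le_of_lt hΦ hφ hC hN0 hN.le x hr (by linarith : r < 2 * r)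
    have h2 : (a : ℝ≥0∞) * orliczNorm Φ (s.indicator f) < a * l := by
      calc (a : ℝ≥0∞) * orliczNorm Φ (s.indicator f)
          ≤ 2 ^ n * invBall Φ x (2 * r) * orliczNorm Φ (s.indicator f) := by
            rw [ha']; gcongr; exact hΦ.invBall_le_two_mul x r
        _ ≤ 2 ^ n * (C * N * φ x r) := by rw [mul_assoc]; gcongr
        _ < a * l := by
            rw [mul_comm (a : ℝ≥0∞), ← ENNReal.coe_mul l a, hla,
              show (2 ^ n * (C * N * φ x r) : ℝ≥0∞) = (2 ^ n * (C * N * φ x r) : ℝ≥0) by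
                push_cast; ring, ENNReal.coe_lt_coe]
            have : 0 < N * φ x r := by positivity
            calc _ < 2 ^ n * (C * N * φ x r) + N * φ x r := lt_add_of_pos_right _ this
              _ = _ := by ring
    exact lt_of_mul_lt_mul_left' h2
  -- For small t the volume of the whole ball is enough. For large t the outer part contributes at
  -- most t/2, so the inner part must exceed t/2 = 2 (t/(4l)) l.
  rcases le_or_gt t (4 * l * a) with ht | ht
  · have h1 : Φ (t / (8 * 5 ^ n * l)) ≤ (volume (Metric.ball x r))⁻¹ := by
      refine le_of_lt_youngInv ?_
      change _ < invBall Φ x r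
      rw [← ha', ENNReal.coe_lt_coe, div_lt_iff₀ (by positivity)]
      have h5 : (1 : ℝ≥0) ≤ 5 ^ n := one_le_pow₀ (by norm_num)
      calc t ≤ 4 * l * a := ht
        _ < 8 * l * a := by gcongr; norm_num
        _ = a * (8 * 1 * l) := by ring
        _ ≤ _ := by gcongr
    calc _ ≤ (volume (Metric.ball x r))⁻¹ * volume (Metric.ball x r) := by
          gcongr
          exact sep_subset _ _
      _ ≤ 1 := ENNReal.inv_mul_le_one _
  · have hsub : {y ∈ Metric.ball x r | (t : ℝ≥0∞) < maximal f y} ⊆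
        {y | 2 * (t / (4 * l) : ℝ≥0) * l < maximal (s.indicator f) y} := by
      rintro y ⟨hy, hty⟩
      have h2 := maximal_le_maximal_indicator_add (f := f) (measurableSet_ball (x := x)
        (ε := 2 * r)) (setLIntegral_diff_ball_le hΦ hφ hC hN0 hN.le hf hr hy)
      have h3 : (2 * 2 ^ n * C * N * φ x r : ℝ≥0∞) ≤ (t / 2 : ℝ≥0) := by
        rw [show (2 * 2 ^ n * C * N * φ x r : ℝ≥0∞) = (2 * 2 ^ n * C * N * φ x r : ℝ≥0) by
          push_cast; ring, ENNReal.coe_le_coe, le_div_iff₀ two_pos]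
        calc _ ≤ 4 * (l * a) := by
              rw [hla]
              calc _ = 4 * ((2 ^ n * C) * N * φ x r) := by ring
                _ ≤ _ := by gcongr; exact le_self_add
          _ = 4 * l * a := by ring
          _ ≤ t := ht.le
      have h4 : (2 * (t / (4 * l) : ℝ≥0) * l : ℝ≥0∞) = (t / 2 : ℝ≥0) := by
        rw [show (2 : ℝ≥0∞) = (2 : ℝ≥0) by simp, ← ENNReal.coe_mul, ← ENNReal.coe_mul]
        congr 1
        field_simp
        ring
      rw [mem_ofPred_eq, h4]
      by_contra! hle
      have h5 : maximal f y ≤ (t / 2 : ℝ≥0) + (t / 2 : ℝ≥0) := h2.trans (by gcongr)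
      rw [← ENNReal.coe_add, add_halves] at h5
      exact h5.not_gt hty
    have hw := hΦ.mul_volume_setOf_lt_le hn (hf.indicator measurableSet_ball) hl0 hI (t / (4 * l))
    have h6 : (5 : ℝ≥0∞) ^ n * Φ (t / (8 * 5 ^ n * l)) ≤ Φ (t / (4 * l)) := by
      have h7 := hΦ.mul_le (m := 5 ^ n) (one_le_pow₀ (by norm_num)) (t / (8 * 5 ^ n * l))
      rw [ENNReal.coe_pow, ENNReal.coe_ofNat] at h7
      refine h7.trans (hΦ.mono ?_)
      rw [show 5 ^ n * (t / (8 * 5 ^ n * l)) = t / (8 * l) by field_simp]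
      gcongr
      norm_num
    have h8 : (5 : ℝ≥0∞) ^ n * (Φ (t / (8 * 5 ^ n * l)) *
        volume {y ∈ Metric.ball x r | (t : ℝ≥0∞) < maximal f y}) ≤ 5 ^ n * 1 := by
      rw [← mul_assoc, mul_one]
      refine le_trans ?_ hw
      gcongr
    exact (ENNReal.mul_le_mul_iff_right (by simp) (by simp)).1 h8

end Maximal

/-! ### Pointwise control, measurability and local integrability of the fractional maximal function
-/

section Fractional

variable {n : ℕ} {F : Type*} [NormedAddCommGroup F] {Φ : ℝ≥0 → ℝ≥0∞} {φ : Eucl n → ℝ → ℝ≥0}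

/-- Slightly smaller concentric balls exhaust B(x,t), and each of them lies in B(z,t) for z near x.
Lower semicontinuity survives the uncountable supremum over t, which measurability alone would not.
-/
lemma lowerSemicontinuous_const_mul_setLIntegral_ball (c : ℝ≥0∞) (g : Eucl n → ℝ≥0∞) (t : ℝ) :
    LowerSemicontinuous fun x : Eucl n => c * ∫⁻ y in Metric.ball x t, g y := by
  intro x a ha
  have hmono : Monotone fun k : ℕ => Metric.ball x (t - 1 / ((k : ℝ) + 1)) := fun i j hij =>
    Metric.ball_subset_ball (sub_le_sub_left (Nat.one_div_le_one_div hij) t)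
  have hU : Metric.ball x t = ⋃ k : ℕ, Metric.ball x (t - 1 / ((k : ℝ) + 1)) := by
    refine Subset.antisymm (fun y hy => ?_)
      (iUnion_subset fun k => Metric.ball_subset_ball (sub_le_self t (by positivity)))
    obtain ⟨k, hk⟩ := exists_nat_one_div_lt (sub_pos.2 (Metric.mem_ball.1 hy))
    exact mem_iUnion.2 ⟨k, Metric.mem_ball.2 (by linarith)⟩
  change a < c * ∫⁻ y in Metric.ball x t, g y at ha
  rw [hU, setLIntegral_iUnion_of_directed _ hmono.directed_le, ENNReal.mul_iSup, lt_iSup_iff] at ha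
  obtain ⟨k, hk⟩ := ha
  filter_upwards [Metric.ball_mem_nhds x (by positivity : (0 : ℝ) < 1 / ((k : ℝ) + 1))] with z hz
  refine hk.trans_le ?_
  gcongr
  rw [Metric.mem_ball, dist_comm] at hz
  exact Metric.ball_subset_ball' (by linarith)

lemma measurable_fracMaximal (α : ℝ) (f : Eucl n → F) : Measurable (fracMaximal α f) := by
  refine LowerSemicontinuous.measurable ?_
  refine lowerSemicontinuous_iSup fun t => lowerSemicontinuous_iSup fun _ => ?_
  simp_rw [Measure.addHaar_ball_center volume _ t]
  exact lowerSemicontinuous_const_mul_setLIntegral_ball _ _ t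

/-- Hedberg type pointwise estimate of the fractional maximal function. -/
lemma exists_fracMaximal_le {α β : ℝ} (hn : n ≠ 0) (hβ : 0 < β) (hβ1 : β < 1) (hα : 0 < α)
    (hΦ : IsYoung Φ) (hφ : ∀ x r, 0 < r → 0 < φ x r) (hadams : AdamsCondition α β φ) :
    ∃ C : ℝ≥0, 0 < C ∧ ∀ f : Eucl n → F, AEStronglyMeasurable f volume → ∀ N : ℝ≥0,
      orliczMorreyNorm Φ φ f ≤ N → ∀ x : Eucl n,
        fracMaximal α f x ≤ (C * N ^ (1 - β) : ℝ≥0) * maximal f x ^ β := by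
  obtain ⟨C, hC⟩ := hadams
  have hv1 := volume_ball_ne_top (0 : Eucl n) 1
  have hβ' : 0 ≤ 1 - β := by linarith
  have hαn : 0 ≤ α / n := by positivity
  set v := volume (Metric.ball (0 : Eucl n) 1)
  set K : ℝ≥0 := v.toNNReal ^ (α / n) * 2 ^ (1 - β) * C with hK
  have hK' : (K : ℝ≥0∞) = v ^ (α / n) * 2 ^ (1 - β) * C := by
    rw [hK, ENNReal.coe_mul, ENNReal.coe_mul, ENNReal.coe_rpow_of_nonneg _ hαn,
      ENNReal.coe_rpow_of_nonneg _ hβ', ENNReal.coe_toNNReal hv1, ENNReal.coe_ofNat]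
  refine ⟨K + 1, by positivity, fun f hf N hN x => iSup₂_le fun t ht => ?_⟩
  have hV0 := volume_ball_ne_zero x ht
  have hV1 := volume_ball_ne_top x t
  have hVα : volume (Metric.ball x t) ^ (α / n) = ENNReal.ofReal (t ^ α) * v ^ (α / n) := by
    have h := volume_ball_mul x (0 : Eucl n) (r := 1) ht
    rw [mul_one] at h
    rw [h, ENNReal.mul_rpow_of_nonneg _ _ hαn, ENNReal.ofReal_rpow_of_nonneg (by positivity) hαn,
      ← Real.rpow_natCast, ← Real.rpow_mul ht.le, mul_div_cancel₀ α (by exact_mod_cast hn)]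
  set A := (volume (Metric.ball x t))⁻¹ * ∫⁻ y in Metric.ball x t, ‖f y‖ₑ with hA
  have hAM : A ≤ maximal f x :=
    le_iSup₂ (f := fun t (_ : 0 < t) => (volume (Metric.ball x t))⁻¹ *
            ∫⁻ y in Metric.ball x t, ‖f y‖ₑ) t ht
  have hAN : A ≤ 2 * (N * φ x t) := by
    rw [hA, ← ENNReal.div_eq_inv_mul, ENNReal.div_le_iff hV0 hV1]
    calc _ ≤ 2 * volume (Metric.ball x t) * invBall Φ x t *
          orliczNorm Φ ((Metric.ball x t).indicator f) :=
          hΦ.setLIntegral_enorm_le hf measurableSet_ball hV0 hV1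
      _ = 2 * (invBall Φ x t * orliczNorm Φ ((Metric.ball x t).indicator f)) *
          volume (Metric.ball x t) := by ring
      _ ≤ _ := by
        gcongr 2 * ?_ * _
        exact invBall_mul_orliczNorm_le hN x ht (hφ x t ht)
  -- The first summand of the Adams condition, taken at radius t, with φ(x,t)^β cancelled.
  have hAd : ENNReal.ofReal (t ^ α) * (φ x t : ℝ≥0∞) ^ (1 - β) ≤ C := by
    have h0 : (φ x t : ℝ≥0∞) ≠ 0 := by simpa using (hφ x t ht).ne'
    have h1 : ((φ x t ^ β : ℝ≥0) : ℝ≥0∞) = (φ x t : ℝ≥0∞) ^ β :=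
      ENNReal.coe_rpow_of_nonneg _ hβ.le
    have h2 : (φ x t : ℝ≥0∞) ^ β ≠ 0 := by
      rw [← h1]; simpa using (NNReal.rpow_pos (hφ x t ht)).ne'
    have h3 : (φ x t : ℝ≥0∞) ^ β ≠ ∞ := by rw [← h1]; exact ENNReal.coe_ne_top
    rw [← ENNReal.mul_le_mul_iff_left h2 h3, mul_assoc, ← ENNReal.rpow_add _ _ h0 ENNReal.coe_ne_top,
      sub_add_cancel, ENNReal.rpow_one, ← h1]
    exact le_self_add.trans (hC x t ht)
  calc volume (Metric.ball x t) ^ (-1 + α / (n : ℝ)) * ∫⁻ y in Metric.ball x t, ‖f y‖ₑ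
      = volume (Metric.ball x t) ^ (α / n) * A := by
        rw [ENNReal.rpow_add _ _ hV0 hV1, ENNReal.rpow_neg_one, hA]; ring
    _ = volume (Metric.ball x t) ^ (α / n) * (A ^ (1 - β) * A ^ β) := by
        rw [← ENNReal.rpow_add_of_nonneg _ _ hβ' hβ.le, sub_add_cancel, ENNReal.rpow_one]
    _ ≤ ENNReal.ofReal (t ^ α) * v ^ (α / n) *
          ((2 * (N * φ x t)) ^ (1 - β) * maximal f x ^ β) := by
        rw [hVα]; gcongr
    _ = v ^ (α / n) * 2 ^ (1 - β) * (ENNReal.ofReal (t ^ α) * (φ x t : ℝ≥0∞) ^ (1 - β)) *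
          (N : ℝ≥0∞) ^ (1 - β) * maximal f x ^ β := by
        rw [ENNReal.mul_rpow_of_nonneg _ _ hβ', ENNReal.mul_rpow_of_nonneg _ _ hβ']; ring
    _ ≤ v ^ (α / n) * 2 ^ (1 - β) * C * (N : ℝ≥0∞) ^ (1 - β) * maximal f x ^ β := by gcongr
    _ ≤ _ := by
        rw [← hK', ← ENNReal.coe_rpow_of_nonneg _ hβ', ← ENNReal.coe_mul]
        gcongr
        exact le_self_add

/-- A dyadic layer-cake bound: the level 2^k T contributes at most 2 T q^k, a convergent geometric
series. -/
lemma lintegral_lt_top_of_forall_mul_meas_le {X : Type*} [MeasurableSpace X] {μ : Measure X}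
    [IsFiniteMeasure μ] {g : X → ℝ≥0∞} (hg : Measurable g) {T : ℝ≥0} (hT : 0 < T) {q : ℝ≥0∞}
    (hq : q < 1) (h : ∀ k : ℕ, 2 ^ k * μ {x | 2 ^ k * T < g x} ≤ q ^ k) :
    ∫⁻ x, g x ∂μ < ∞ := by
  have hmeas : ∀ k : ℕ, MeasurableSet {x | 2 ^ k * (T : ℝ≥0∞) < g x} := fun k =>
    measurableSet_lt measurable_const hg
  have hpt : ∀ x, g x ≤ T + ∑' k : ℕ,
      {x | 2 ^ k * (T : ℝ≥0∞) < g x}.indicator (fun _ => 2 * (2 ^ k * (T : ℝ≥0∞))) x := by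
    intro x
    have hT0 : (T : ℝ≥0∞) ≠ 0 := by simpa using hT.ne'
    by_cases hex : ∃ k : ℕ, g x ≤ 2 ^ k * T
    · classical
      have hmin := fun {m} => Nat.find_min hex (m := m)
      have hspec := Nat.find_spec hex
      rcases hm : Nat.find hex with _ | m
      · rw [hm] at hspec
        exact le_add_right (by simpa using hspec)
      · rw [hm] at hspec
        have hlt : 2 ^ m * (T : ℝ≥0∞) < g x := not_le.1 (hmin (by omega))
        refine le_add_left (le_trans ?_ (ENNReal.le_tsum m))
        rw [indicator_of_mem (by exact hlt)]
        exact hspec.trans_eq (by ring)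
    -- When g x exceeds every dyadic level, all indicators equal their full weight and the series is
    -- infinite.
    · push Not at hex
      refine le_add_left (le_trans le_top (top_le_iff.2 ?_).ge)
      rw [← top_le_iff, ← ENNReal.tsum_const_eq_top_of_ne_zero (α := ℕ) hT0]
      refine ENNReal.tsum_le_tsum fun k => ?_
      rw [indicator_of_mem (by exact hex k), ← mul_assoc]
      refine le_mul_of_one_le_left zero_le ?_
      rw [← pow_succ']
      exact one_le_pow₀ (by norm_num)
  calc ∫⁻ x, g x ∂μ ≤ _ := lintegral_mono hpt
    _ = T * μ univ + ∑' k : ℕ, 2 * (2 ^ k * T) * μ {x | 2 ^ k * (T : ℝ≥0∞) < g x} := by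
        rw [lintegral_add_left measurable_const, lintegral_const, lintegral_tsum fun k =>
          (measurable_const.indicator (hmeas k)).aemeasurable]
        simp_rw [lintegral_indicator_const (hmeas _)]
    _ ≤ T * μ univ + ∑' k : ℕ, 2 * T * q ^ k := by
        gcongr T * μ univ + ∑' k : ℕ, ?_ with k
        calc _ = 2 * T * (2 ^ k * μ {x | 2 ^ k * (T : ℝ≥0∞) < g x}) := by ring
          _ ≤ _ := by gcongr; exact h k
    _ < ∞ := by
        rw [ENNReal.tsum_mul_left, ENNReal.tsum_geometric]
        refine ENNReal.add_lt_top.2 ⟨ENNReal.mul_lt_top ENNReal.coe_lt_top (measure_lt_top _ _),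
          ENNReal.mul_lt_top (ENNReal.mul_lt_top (by simp) ENNReal.coe_lt_top) ?_⟩
        rw [ENNReal.inv_lt_top]
        exact tsub_pos_of_lt hq

/-- On sets of finite measure, the weak space for `t ↦ Φ(t^{1/β})` with `β < 1` embeds in `L¹`. -/
lemma IsYoung.setLIntegral_lt_top {β : ℝ} (hβ : 0 < β) (hβ1 : β < 1) (hΦ : IsYoung Φ)
    {g : Eucl n → ℝ≥0∞} (hg : Measurable g) {s : Set (Eucl n)} (hs1 : volume s ≠ ∞) {l : ℝ≥0} (hl : 0 < l)
    (h : ∀ t : ℝ≥0, Φ ((t / l) ^ (1 / β)) * volume {x ∈ s | (t : ℝ≥0∞) < g x} ≤ 1) :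
    ∫⁻ x in s, g x < ∞ := by
  have : IsFiniteMeasure (volume.restrict s) := ⟨by
    rw [Measure.restrict_apply_univ]; exact lt_top_iff_ne_top.2 hs1⟩
  obtain ⟨u, hu1, hu0⟩ := ((hΦ.tendsto_top.eventually (lt_mem_nhds ENNReal.one_lt_top)).and
    (eventually_gt_atTop 0)).exists
  have hβ0 : 0 < 1 / β := one_div_pos.2 hβ
  have hβ1' : 1 < 1 / β := by rwa [one_lt_div hβ]
  set w : ℝ≥0 := 2 ^ (1 / β) with hw
  have hw2 : 2 < w := by
    calc (2 : ℝ≥0) = 2 ^ (1 : ℝ) := (NNReal.rpow_one 2).symm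
      _ < w := NNReal.rpow_lt_rpow_of_exponent_lt one_lt_two hβ1'
  have hw0 : 0 < w := two_pos.trans hw2
  -- At level 2^k T the argument of Φ is w^k u, and Φ u > 1 gives Φ(w^k u) ≥ w^k. The level set then
  -- has measure at most w^(-k), and 2/w < 1 because β < 1.
  refine lintegral_lt_top_of_forall_mul_meas_le hg (T := u ^ β * l) (q := (2 / w : ℝ≥0))
    (mul_pos (NNReal.rpow_pos hu0) hl) ?_ fun k => ?_
  · rw [← ENNReal.coe_one, ENNReal.coe_lt_coe, div_lt_one hw0]
    exact hw2
  have hk := h (2 ^ k * (u ^ β * l))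
  have h1 : (2 ^ k * (u ^ β * l) / l) ^ (1 / β) = w ^ k * u := by
    rw [← mul_assoc, mul_div_cancel_right₀ _ hl.ne', NNReal.mul_rpow, ← NNReal.rpow_mul,
      mul_one_div_cancel hβ.ne', NNReal.rpow_one, hw, ← NNReal.rpow_natCast, ← NNReal.rpow_natCast,
      ← NNReal.rpow_mul, ← NNReal.rpow_mul, mul_comm (k : ℝ)]
  have h2 : (w ^ k : ℝ≥0) ≤ Φ (w ^ k * u) :=
    calc ((w ^ k : ℝ≥0) : ℝ≥0∞) ≤ (w ^ k : ℝ≥0) * Φ u := le_mul_of_one_le_right zero_le hu1.le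
      _ ≤ _ := hΦ.mul_le (one_le_pow₀ (one_le_two.trans hw2.le)) u
  rw [h1] at hk
  have h3 : volume.restrict s {x | 2 ^ k * ((u ^ β * l : ℝ≥0) : ℝ≥0∞) < g x} ≤
      ((w ^ k : ℝ≥0) : ℝ≥0∞)⁻¹ := by
    rw [Measure.restrict_apply (measurableSet_lt measurable_const hg), inter_comm,
      ENNReal.le_inv_iff_mul_le, mul_comm]
    refine le_trans ?_ hk
    gcongr
    rintro x ⟨hx, hx'⟩
    refine ⟨hx, ?_⟩
    rw [mem_ofPred_eq] at hx'
    rwa [ENNReal.coe_mul, ENNReal.coe_pow, ENNReal.coe_ofNat]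
  calc _ ≤ 2 ^ k * ((w ^ k : ℝ≥0) : ℝ≥0∞)⁻¹ := by gcongr
    _ = _ := by
      rw [← ENNReal.coe_inv (pow_pos hw0 k).ne', ← ENNReal.coe_pow, div_pow, div_eq_mul_inv,
        ENNReal.coe_mul, ENNReal.coe_pow, ENNReal.coe_ofNat]

end Fractional

/-! ### Transfer to the fractional maximal operator -/

section Main

variable {n : ℕ} {F : Type*} [NormedAddCommGroup F] {Φ Ψ : ℝ≥0 → ℝ≥0∞}

/-- Passing from a weak bound for `maximal f` to one for a function dominated by a power of it. -/
lemma mul_volume_setOf_lt_le_of_le_rpow {β : ℝ} (hβ : 0 < β) {g h : Eucl n → ℝ≥0∞}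
    {s : Set (Eucl n)} {l D : ℝ≥0} (hD : 0 < D)
    (hgh : ∀ x, g x ≤ D * h x ^ β)
    (hw : ∀ t : ℝ≥0, Φ (t / l) * volume {x ∈ s | (t : ℝ≥0∞) < h x} ≤ 1) (t : ℝ≥0) :
    Φ ((t / (D * l ^ β)) ^ (1 / β)) * volume {x ∈ s | (t : ℝ≥0∞) < g x} ≤ 1 := by
  have h1 : (t / (D * l ^ β)) ^ (1 / β) = (t / D) ^ (1 / β) / l := by
    rw [← div_div, NNReal.div_rpow, ← NNReal.rpow_mul l, mul_one_div_cancel hβ.ne',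
      NNReal.rpow_one]
  rw [h1]
  refine le_trans ?_ (hw ((t / D) ^ (1 / β)))
  refine mul_le_mul_right (measure_mono ?_) _
  rintro x ⟨hx, hxt⟩
  refine ⟨hx, ?_⟩
  by_contra! hle
  refine hxt.not_ge ((hgh x).trans ?_)
  calc (D : ℝ≥0∞) * h x ^ β ≤ D * (((t / D) ^ (1 / β) : ℝ≥0) : ℝ≥0∞) ^ β := by gcongr
    _ = t := by
      rw [← ENNReal.coe_rpow_of_nonneg _ hβ.le, ← NNReal.rpow_mul, one_div_mul_cancel hβ.ne',
        NNReal.rpow_one, ← ENNReal.coe_mul, mul_div_cancel₀ t hD.ne']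

lemma weakOrliczNorm_indicator_le {g : Eucl n → ℝ≥0∞} {s : Set (Eucl n)} {l : ℝ≥0} (hl : 0 < l)
    (h : ∀ t : ℝ≥0, Φ (t / l) * volume {x ∈ s | (t : ℝ≥0∞) < g x} ≤ 1) :
    weakOrliczNorm Φ (s.indicator g) ≤ l := by
  refine iInf₂_le l ⟨hl, iSup₂_le fun t _ => le_trans ?_ (h t)⟩
  refine mul_le_mul_right (measure_mono fun x hx => ?_) _
  rw [mem_ofPred_eq, enorm_eq_self] at hx
  by_cases hxs : x ∈ s
  · rw [indicator_of_mem hxs] at hx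
    exact ⟨hxs, hx⟩
  · rw [indicator_of_notMem hxs] at hx
    exact absurd hx not_lt_zero

lemma locallyIntegrable_indicator_of_lintegral_lt_top {g : Eucl n → ℝ≥0∞} (hg : Measurable g)
    {s : Set (Eucl n)} (hs : MeasurableSet s) (h : ∫⁻ x in s, g x < ∞) :
    LocallyIntegrable (s.indicator g) volume := by
  refine fun x => ⟨univ, univ_mem, ?_⟩
  rw [integrableOn_univ]
  refine ⟨(hg.indicator hs).aestronglyMeasurable, ?_⟩
  simp only [HasFiniteIntegral, enorm_eq_self]
  rwa [lintegral_indicator hs]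

/-- Weak boundedness of the fractional maximal operator on generalized Orlicz-Morrey spaces. -/
theorem exists_weakOrliczMorreyNorm_fracMaximal_le {α β : ℝ} (hα : 0 < α) (hαn : α < n)
    (hβ : 0 < β) (hβ1 : β < 1) (hΦ : IsYoung Φ) {φ η : Eucl n → ℝ → ℝ≥0}
    (hφ : ∀ x r, 0 < r → 0 < φ x r) (hmax : MaximalCondition Φ φ) (hadams : AdamsCondition α β φ)
    (hΨ : ∀ t, Ψ t = Φ (t ^ (1 / β))) (hη : ∀ x r, η x r = φ x r ^ β) :
    ∃ C : ℝ≥0, ∀ f : Eucl n → F, MemOrliczMorrey Φ φ f →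
      MemWeakOrliczMorrey Ψ η (fracMaximal α f) ∧
      weakOrliczMorreyNorm Ψ η (fracMaximal α f) ≤ C * orliczMorreyNorm Φ φ f := by
  have hn : n ≠ 0 := by
    rintro rfl
    exact (hα.trans hαn).ne' (by simp)
  obtain ⟨C₁, hC₁, hweak⟩ := exists_weak_maximal_bound (F := F) hn hΦ hφ hmax
  obtain ⟨C₂, hC₂, hpt⟩ := exists_fracMaximal_le (F := F) hn hβ hβ1 hα hΦ hφ hadams
  refine ⟨C₂ * C₁ ^ β, fun f ⟨hf, hfin⟩ => ?_⟩
  have hfm := hf.locallyIntegrable.aestronglyMeasurable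
  have hmeas := measurable_fracMaximal α f
  have key : ∀ N : ℝ≥0, orliczMorreyNorm Φ φ f < N → ∀ (x : Eucl n) (r : ℝ), 0 < r →
      ∃ l : ℝ≥0, 0 < l ∧ (φ x r ^ β)⁻¹ * (invBall Φ x r).toNNReal ^ β * l = C₂ * C₁ ^ β * N ∧
        ∀ t : ℝ≥0, Φ ((t / l) ^ (1 / β)) *
          volume {y ∈ Metric.ball x r | (t : ℝ≥0∞) < fracMaximal α f y} ≤ 1 := by
    intro N hN x r hr
    have hN0 : 0 < N := ENNReal.coe_pos.1 (zero_le.trans_lt hN)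
    have hφ0 := hφ x r hr
    have ha0 : 0 < (invBall Φ x r).toNNReal :=
      ENNReal.toNNReal_pos (hΦ.invBall_ne_zero x r) (hΦ.invBall_ne_top x hr)
    set a := (invBall Φ x r).toNNReal
    have hD : 0 < C₂ * N ^ (1 - β) := mul_pos hC₂ (NNReal.rpow_pos hN0)
    -- The Hedberg constant times the β-th power of the weak scale of `maximal f`.
    refine ⟨C₂ * N ^ (1 - β) * (C₁ * N * φ x r / a) ^ β,
      mul_pos hD (NNReal.rpow_pos (by positivity)), ?_,
      mul_volume_setOf_lt_le_of_le_rpow hβ hD (hpt f hfm N hN.le) (hweak f hfm N hN x r hr)⟩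
    have h1 : N ^ (1 - β) * N ^ β = N := by
      rw [← NNReal.rpow_add hN0.ne', sub_add_cancel, NNReal.rpow_one]
    have h2 := NNReal.rpow_pos (p := β) hφ0
    have h3 := NNReal.rpow_pos (p := β) ha0
    rw [NNReal.div_rpow, NNReal.mul_rpow, NNReal.mul_rpow]
    calc _ = C₂ * C₁ ^ β * (N ^ (1 - β) * N ^ β) * ((φ x r ^ β)⁻¹ * φ x r ^ β) *
          (a ^ β / a ^ β) := by ring
      _ = _ := by rw [h1, inv_mul_cancel₀ h2.ne', div_self h3.ne', mul_one, mul_one]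
  have hnorm : ∀ N : ℝ≥0, orliczMorreyNorm Φ φ f < N →
      weakOrliczMorreyNorm Ψ η (fracMaximal α f) ≤ (C₂ * C₁ ^ β * N : ℝ≥0) := by
    intro N hN
    refine iSup_le fun x => iSup₂_le fun r hr => ?_
    obtain ⟨l, hl0, hl, hlw⟩ := key N hN x r hr
    have h1 : invBall Ψ x r ≤ ((invBall Φ x r).toNNReal ^ β : ℝ≥0) := by
      rw [ENNReal.coe_rpow_of_nonneg _ hβ.le, ENNReal.coe_toNNReal (hΦ.invBall_ne_top x hr)]
      exact youngInv_rpow_le hβ hΨ _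
    rw [← hl, hη, ENNReal.coe_mul, ENNReal.coe_mul,
      ENNReal.coe_inv (NNReal.rpow_pos (hφ x r hr)).ne']
    gcongr
    exact weakOrliczNorm_indicator_le hl0 fun t => by rw [hΨ]; exact hlw t
  obtain ⟨N, hN⟩ := ENNReal.lt_iff_exists_nnreal_btwn.1 hfin
  refine ⟨⟨fun x r hr => ?_, (hnorm N hN.1).trans_lt ENNReal.coe_lt_top⟩, ?_⟩
  · obtain ⟨l, hl0, -, hlw⟩ := key N hN.1 x r hr
    exact ⟨locallyIntegrable_indicator_of_lintegral_lt_top hmeas measurableSet_ball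
      (hΦ.setLIntegral_lt_top hβ hβ1 hmeas (volume_ball_ne_top x r) hl0 hlw),
      (weakOrliczNorm_indicator_le hl0 fun t => by rw [hΨ]; exact hlw t).trans_lt
        ENNReal.coe_lt_top⟩
  -- The bound holds for every N strictly above the norm, which keeps N positive even at norm zero;
  -- letting N decrease to M gives the claim.
  · lift orliczMorreyNorm Φ φ f to ℝ≥0 using hfin.ne with M
    have hC : 0 < C₂ * C₁ ^ β := mul_pos hC₂ (NNReal.rpow_pos hC₁)
    refine ENNReal.le_of_forall_pos_le_add fun ε hε _ => ?_
    refine (hnorm (M + ε / (C₂ * C₁ ^ β)) ?_).trans_eq ?_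
    · rw [ENNReal.coe_lt_coe]
      exact lt_add_of_pos_right _ (by positivity)
    · rw [mul_add, mul_div_cancel₀ ε hC.ne', ENNReal.coe_add, ENNReal.coe_mul]

end Main

end OrliczMorrey

theorem mainTheorem4 {𝕜 : Type*} [RCLike 𝕜] (n : ℕ) (α β : ℝ) (hα : 0 < α) (hαn : α < n)
    (hβ : 0 < β) (hβ1 : β < 1)
    (Φ : ℝ≥0 → ℝ≥0∞) (hΦ : OrliczMorrey.IsYoung Φ) (hΦ' : OrliczMorrey.DeltaPrime Φ)
    (φ : OrliczMorrey.Eucl n → ℝ → ℝ≥0) (hφ : OrliczMorrey.MemOmega Φ φ)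
    (hmax : OrliczMorrey.MaximalCondition Φ φ)
    (hadams : OrliczMorrey.AdamsCondition α β φ)
    (Ψ : ℝ≥0 → ℝ≥0∞) (hΨ : ∀ t, Ψ t = Φ (t ^ (1 / β)))
    (η : OrliczMorrey.Eucl n → ℝ → ℝ≥0) (hη : ∀ x r, η x r = φ x r ^ β) :
    ∃ C : ℝ≥0, ∀ f : OrliczMorrey.Eucl n → 𝕜, OrliczMorrey.MemOrliczMorrey Φ φ f →
      OrliczMorrey.MemWeakOrliczMorrey Ψ η (OrliczMorrey.fracMaximal α f) ∧
      OrliczMorrey.weakOrliczMorreyNorm Ψ η (OrliczMorrey.fracMaximal α f)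
        ≤ C * OrliczMorrey.orliczMorreyNorm Φ φ f :=
  OrliczMorrey.exists_weakOrliczMorreyNorm_fracMaximal_le hα hαn hβ hβ1 hΦ hφ.pos hmax hadams hΨ hη
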